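/- Let $\mathcal{L}_{rings}=\{+,-,\cdot,0,1\}$. For a number field $K$ let $V_K$ be the set of its (Archimedean and non-Archimedean) places and $\mathbb{A}_K=\prod'_{v\in V_K}K_v$ its ring of adeles. Let $\mathbb{B}_K=\{e\in\mathbb{A}_K : e^2=e\}$ be the Boolean algebra of idempotents, ordered by $e\le f\Leftrightarrow ef=e$; its atoms are called minimal idempotents. For an $\mathcal{L}_{rings}$-formula $\psi(x_1,\dots,x_n)$ and $a\in\mathbb{A}_K^n$ let $[[\psi(a)]]\in\mathbb{B}_K$ be the supremum of all minimal idempotents $e$ such that $e\mathbb{A}_K\models\psi(ea_1,\dots,ea_n)$, where $e\mathbb{A}_K$ is a ring with unit element $e$. For $e\in\mathbb{B}_K$, $Fin(e)$ says that $\{v\in V_K: e(v)\neq 0\}$ is finite, and, for $j\ge 1$, $C_j(e)$ says that there are at least $j$ distinct minimal idempotents $f\le e$. (a) For every $\mathcal{L}_{rings}$-formula $\psi(x_1,\dots,x_n)$ and every $j\ge 1$, the conditions $Fin([[\psi(x_1,\dots,x_n)]])$ and $C_j([[\psi(x_1,\dots,x_n)]])$ on $\mathbb{A}_K^n$ are defined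 by $\mathcal{L}_{rings}$-formulas that do not depend on the number field $K$. (b) For every $\mathcal{L}_{rings}$-formula $\varphi(x_1,\dots,x_n)$ there are $l\ge 1$, $\mathcal{L}_{rings}$-formulas $\psi_1(x_1,\dots,x_n),\dots,\psi_l(x_1,\dots,x_n)$ and a Boolean combination $\Psi(x_1,\dots,x_n)$ of conditions $Fin([[\psi_k(x_1,\dots,x_n)]])$ and $C_j([[\psi_s(x_1,\dots,x_n)]])$ with $k,s\in\{1,\dots,l\}$ and $j\ge 1$, all independent of $K$, such that for every number field $K$ $$\mathbb{A}_K\models\forall x_1\dots\forall x_n\,(\varphi(x_1,\dots,x_n)\Leftrightarrow\Psi(x_1,\dots,x_n)).$$ (c) Let $K$ be a number field and let $A\subseteq\mathbb{A}_K$ be any set of parameters (possibly empty). Every subset of $\mathbb{A}_K^n$ that is definable in the language of rings with parameters from $A$ is a Boolean combination of sets of the forms $\{x: Fin([[\psi(x,b)]])\}$ and $\{x: C_j([[\phi(x,b)]])\}$, where $j\ge1$, $\psi,\phi$ are $\mathcal{L}_{rings}$-formulas and $b$ is a finite tuple from $A$. -/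

import Mathlib

open FirstOrder FirstOrder.Language NumberField IsDedekindDomain
open scoped NumberField.AdeleRing

universe u

/-- `R ⊨ φ(v)`, where the commutative ring `R` is viewed as a structure for the language of rings. -/
def RingSat {R : Type*} [CommRing R] {α : Type*} (φ : Language.ring.Formula α) (v : α → R) : Prop :=
  letI := FirstOrder.Ring.compatibleRingOfRing R
  φ.Realize v

/-- `D ⊆ R ^ α` is definable in the ring `R` with parameters from `A ⊆ R`. -/
def RingDefinable {R : Type*} [CommRing R] {α : Type*} (A : Set R) (D : Set (α → R)) : Prop :=
  letI := FirstOrder.Ring.compatibleRingOfRing R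
  A.Definable Language.ring D

/-- The idempotents of `R`. Mathlib makes this a Boolean algebra, with `e ≤ f ↔ e * f = e`,
`e ⊓ f = e * f`, `e ⊔ f = e + f - e * f` and `eᶜ = 1 - e`. -/
abbrev Idem (R : Type*) [CommRing R] : Type _ := {e : R // IsIdempotentElem e}

/-- The element `e a` of the ring `e R`, whose unit element is `e`. -/
def toCorner {R : Type*} [CommRing R] (e : Idem R) (a : R) : e.2.Corner :=
  ⟨e * a * e, a, rfl⟩

/-- The minimal (nonzero) idempotents `e` of `R` such that `eR ⊨ φ(e a)`. -/
def satAtoms {R : Type*} [CommRing R] {α : Type*} (φ : Language.ring.Formula α) (a : α → R) :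
    Set (Idem R) :=
  {e | IsAtom e ∧ RingSat φ (fun i => toCorner e (a i))}

section Adeles

variable (K : Type u) [Field K] [NumberField K]

/-- The set `V_K` of places of the number field `K`: Archimedean and non-Archimedean. -/
abbrev Place : Type u := InfinitePlace K ⊕ HeightOneSpectrum (𝓞 K)

variable {K}

/-- The set of the places `v` with `a(v) ≠ 0`. -/
def adeleSupport (a : 𝔸[K]) : Set (Place K) :=
  {v | Sum.elim (fun w => a.1 w ≠ 0) (fun p => a.2 p ≠ 0) v}

open Classical in
/-- The idempotent adele `e_X` with component `1` at the places in `X` and `0` elsewhere. -/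
noncomputable def indicatorAdele (X : Set (Place K)) : 𝔸[K] :=
  (fun w => if Sum.inl w ∈ X then 1 else 0,
   ⟨fun p => if Sum.inr p ∈ X then 1 else 0, Filter.Eventually.of_forall fun p => by
      beta_reduce
      split_ifs
      · exact one_mem _
      · exact zero_mem _⟩)

theorem adele_ext {a b : 𝔸[K]} (h : ∀ w, a.1 w = b.1 w) (h' : ∀ p, a.2 p = b.2 p) : a = b :=
  Prod.ext (funext h) (DFunLike.ext _ _ h')

theorem idem_comp_fst {e : 𝔸[K]} (he : IsIdempotentElem e) (w : InfinitePlace K) :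
    e.1 w = 0 ∨ e.1 w = 1 :=
  IsIdempotentElem.iff_eq_zero_or_one.mp (congrFun (congrArg Prod.fst he.eq) w)

theorem idem_comp_snd {e : 𝔸[K]} (he : IsIdempotentElem e) (p : HeightOneSpectrum (𝓞 K)) :
    e.2 p = 0 ∨ e.2 p = 1 :=
  IsIdempotentElem.iff_eq_zero_or_one.mp (DFunLike.congr_fun (congrArg Prod.snd he.eq) p)

theorem isIdempotentElem_indicatorAdele (X : Set (Place K)) :
    IsIdempotentElem (indicatorAdele X) := by
  classical
  refine adele_ext (fun w => ?_) fun p => ?_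
  · change (if _ then (1 : w.Completion) else 0) * (if _ then 1 else 0) = if _ then 1 else 0
    split_ifs <;> simp
  · change (if _ then (1 : p.adicCompletion K) else 0) * (if _ then 1 else 0) = if _ then 1 else 0
    split_ifs <;> simp

theorem idem_le_iff {e f : Idem 𝔸[K]} :
    e ≤ f ↔ adeleSupport (e : 𝔸[K]) ⊆ adeleSupport (f : 𝔸[K]) := by
  change (e : 𝔸[K]) * f = e ↔ _
  constructor
  · rintro h (w | p) hv hf
    · exact hv ((congrFun (congrArg Prod.fst h) w).symm.trans
        ((congrArg ((e : 𝔸[K]).1 w * ·) hf).trans (mul_zero _)))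
    · exact hv ((DFunLike.congr_fun (congrArg Prod.snd h) p).symm.trans
        ((congrArg ((e : 𝔸[K]).2 p * ·) hf).trans (mul_zero _)))
  · refine fun h => adele_ext (fun w => ?_) fun p => ?_
    · change (e : 𝔸[K]).1 w * (f : 𝔸[K]).1 w = _
      rcases idem_comp_fst e.2 w with he | he
      · rw [he, zero_mul]
      · have hf : (f : 𝔸[K]).1 w ≠ 0 := h (show Sum.inl w ∈ adeleSupport (e : 𝔸[K]) from
          (he.trans_ne one_ne_zero : (e : 𝔸[K]).1 w ≠ 0))
        rw [(idem_comp_fst f.2 w).resolve_left hf, mul_one]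
    · change (e : 𝔸[K]).2 p * (f : 𝔸[K]).2 p = _
      rcases idem_comp_snd e.2 p with he | he
      · rw [he, zero_mul]
      · have hf : (f : 𝔸[K]).2 p ≠ 0 := h (show Sum.inr p ∈ adeleSupport (e : 𝔸[K]) from
          (he.trans_ne one_ne_zero : (e : 𝔸[K]).2 p ≠ 0))
        rw [(idem_comp_snd f.2 p).resolve_left hf, mul_one]

theorem adeleSupport_indicatorAdele (X : Set (Place K)) :
    adeleSupport (indicatorAdele X) = X := by
  classical
  ext (w | p)
  · change (if _ then (1 : w.Completion) else 0) ≠ 0 ↔ _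
    split_ifs with h <;> simp [h]
  · change (if _ then (1 : p.adicCompletion K) else 0) ≠ 0 ↔ _
    split_ifs with h <;> simp [h]

/-- Every set of idempotents of the adele ring has a supremum. -/
theorem exists_isLUB_idem (S : Set (Idem 𝔸[K])) : ∃ e, IsLUB S e := by
  refine ⟨⟨_, isIdempotentElem_indicatorAdele (⋃ e ∈ S, adeleSupport (e : 𝔸[K]))⟩,
    fun e he => ?_, fun f hf => ?_⟩
  · rw [idem_le_iff, adeleSupport_indicatorAdele]
    exact Set.subset_biUnion_of_mem (u := fun e : Idem 𝔸[K] => adeleSupport (e : 𝔸[K])) he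
  · rw [idem_le_iff, adeleSupport_indicatorAdele]
    exact Set.iUnion₂_subset fun e he => idem_le_iff.mp (hf he)

/-- The Boolean value `[[φ(a)]]`: the supremum in the Boolean algebra of idempotents of `𝔸[K]` of
all minimal idempotents `e` such that `e 𝔸[K] ⊨ φ(e a)`. -/
noncomputable def boolValue {α : Type*} (φ : Language.ring.Formula α) (a : α → 𝔸[K]) :
    Idem 𝔸[K] :=
  (exists_isLUB_idem (satAtoms φ a)).choose

theorem isLUB_boolValue {α : Type*} (φ : Language.ring.Formula α) (a : α → 𝔸[K]) :
    IsLUB (satAtoms φ a) (boolValue φ a) :=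
  (exists_isLUB_idem (satAtoms φ a)).choose_spec

/-- `Fin(e)`: the idempotent `e` has finite support. -/
def IsFin (e : Idem 𝔸[K]) : Prop := (adeleSupport (e : 𝔸[K])).Finite

/-- `C_j(e)`: there are at least `j` distinct minimal idempotents below `e`. -/
def HasAtoms (j : ℕ) (e : Idem 𝔸[K]) : Prop :=
  (j : ℕ∞) ≤ {f : Idem 𝔸[K] | IsAtom f ∧ f ≤ e}.encard

end Adeles

/-- Boolean combinations of the conditions `Fin(X_k)` and `C_j(X_s)`, `j ≥ 1`, on an `l`-tuple
`X` of elements of a Boolean algebra. -/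
inductive BoolComb (l : ℕ) : Type
  | fin (k : Fin l) : BoolComb l
  | atoms (j : ℕ) (hj : 1 ≤ j) (s : Fin l) : BoolComb l
  | not (B : BoolComb l) : BoolComb l
  | and (B C : BoolComb l) : BoolComb l
  | or (B C : BoolComb l) : BoolComb l

/-- The truth value of a Boolean combination at a tuple of idempotents of the adele ring. -/
def BoolComb.Holds {K : Type u} [Field K] [NumberField K] {l : ℕ} (X : Fin l → Idem 𝔸[K]) :
    BoolComb l → Prop
  | .fin k => IsFin (X k)
  | .atoms j _ s => HasAtoms j (X s)
  | .not B => ¬ B.Holds X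
  | .and B C => B.Holds X ∧ C.Holds X
  | .or B C => B.Holds X ∨ C.Holds X

/-! The adele ring is a restricted product of the completions, and the restriction is first-order:
one ring formula χ, `squareRingFormula`, independent of `K`, defines the valuation ring at every
finite place not above 2. Since only finitely many places are left over, the adeles are exactly the
families satisfying χ at almost all places.

For such restricted products a Feferman–Vaught theorem holds (`isDetermined`): the truth of φ
depends only on how many indices show each truth pattern of finitely many formulas, counted up to a
threshold and up to the distinction between finite and infinite. The quantifier step is a
back-and-forth argument. The indices are coloured by the patterns that a new element produces, and
the colouring is copied to the other product (`exists_coloring`). Since χ is one of the formulas,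
the copied family again lies in the restricted product. The theorem compares two different products,
hence adeles of two different number fields, and this makes the elimination uniform in `K`.

Minimal idempotents are the indicators `e_v` of single places, and `e_v 𝔸` is the completion at `v`.
So `Fin` and `C_j` of a Boolean value are statements about the number of places where a formula
holds, which are just the data that determine φ. A class determined by finitely many conditions is a
Boolean combination of them (`BooleanSubalgebra.mem_of_forall_iff`).

Conversely, `C_j` is definable by quantifying over minimal idempotents, and `Fin` because the places
where an adele violates χ form a finite set, arbitrary among the places where χ can fail
(`finite_satPlaces_iff`). -/

/-! ### Cardinalities up to a threshold -/

/-- `m` and `n` are equal, or both at least `N` and both finite or both infinite. -/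
def CardEquiv (N : ℕ) (m n : ℕ∞) : Prop :=
  m = n ∨ (N : ℕ∞) ≤ m ∧ (N : ℕ∞) ≤ n ∧ (m = ⊤ ↔ n = ⊤)

namespace CardEquiv

theorem symm {N : ℕ} {m n : ℕ∞} (h : CardEquiv N m n) : CardEquiv N n m :=
  h.imp Eq.symm fun h => ⟨h.2.1, h.1, h.2.2.symm⟩

theorem mono {N N' : ℕ} {m n : ℕ∞} (hN : N ≤ N') (h : CardEquiv N' m n) : CardEquiv N m n :=
  h.imp_right fun h =>
    ⟨(Nat.cast_le.2 hN).trans h.1, (Nat.cast_le.2 hN).trans h.2.1, h.2.2⟩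

theorem eq_top_iff {N : ℕ} {m n : ℕ∞} (h : CardEquiv N m n) : m = ⊤ ↔ n = ⊤ := by
  rcases h with rfl | h
  · rfl
  · exact h.2.2

theorem eq_zero_iff {N : ℕ} {m n : ℕ∞} (hN : 1 ≤ N) (h : CardEquiv N m n) : m = 0 ↔ n = 0 := by
  rcases h with rfl | ⟨h, h', -⟩
  · rfl
  · have : (1 : ℕ∞) ≤ N := mod_cast hN
    exact iff_of_false (Order.one_le_iff_ne_zero.1 (this.trans h))
      (Order.one_le_iff_ne_zero.1 (this.trans h'))

theorem add {N : ℕ} {a b c d : ℕ∞} (h : CardEquiv N a b) (h' : CardEquiv N c d) :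
    CardEquiv N (a + c) (b + d) := by
  by_cases he : a = b ∧ c = d
  · exact .inl (by rw [he.1, he.2])
  have key : (N : ℕ∞) ≤ a + c ∧ (N : ℕ∞) ≤ b + d := by
    rcases h with rfl | h
    · rcases h' with rfl | h'
      · exact absurd ⟨rfl, rfl⟩ he
      · exact ⟨h'.1.trans le_add_self, h'.2.1.trans le_add_self⟩
    · exact ⟨h.1.trans le_self_add, h.2.1.trans le_self_add⟩
  exact .inr ⟨key.1, key.2, by simp only [ENat.add_eq_top, h.eq_top_iff, h'.eq_top_iff]⟩

/-- Equivalence at threshold `N + M` lets one split a sum with thresholds `N` and `M`. -/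
theorem exists_split {N M : ℕ} {f r b : ℕ∞} (h : CardEquiv (N + M) (f + r) b) :
    ∃ f' r', f' + r' = b ∧ CardEquiv N f f' ∧ CardEquiv M r r' := by
  rcases h with rfl | ⟨h₁, h₂, h₃⟩
  · exact ⟨f, r, rfl, .inl rfl, .inl rfl⟩
  -- If `b` is infinite, one of `f`, `r` is infinite, and the same pair works.
  by_cases hb : b = ⊤
  · subst hb
    rcases ENat.add_eq_top.1 (h₃.2 rfl) with rfl | rfl
    · exact ⟨⊤, r, by simp, .inl rfl, .inl rfl⟩
    · exact ⟨f, ⊤, by simp, .inl rfl, .inl rfl⟩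
  have ha : f + r ≠ ⊤ := fun h => hb (h₃.1 h)
  lift b to ℕ using hb
  have hf : f ≠ ⊤ := fun h => ha (by simp [h])
  have hr : r ≠ ⊤ := fun h => ha (by simp [h])
  lift f to ℕ using hf
  lift r to ℕ using hr
  norm_cast at h₁ h₂
  -- A summand below its threshold must be kept exactly; the other one is then large and absorbs the
  -- difference.
  have key : ∃ f' r' : ℕ, f' + r' = b ∧ (f = f' ∨ N ≤ f ∧ N ≤ f') ∧ (r = r' ∨ M ≤ r ∧ M ≤ r') := by
    by_cases hrM : M ≤ r
    · by_cases hfN : N ≤ f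
      · exact ⟨N, b - N, by omega, by omega, by omega⟩
      · exact ⟨f, b - f, by omega, by omega, by omega⟩
    · exact ⟨b - r, r, by omega, by omega, by omega⟩
  obtain ⟨f', r', h, h', h''⟩ := key
  refine ⟨f', r', mod_cast h, h'.imp (congrArg _) fun h => ⟨mod_cast h.1, mod_cast h.2, by simp⟩,
    h''.imp (congrArg _) fun h => ⟨mod_cast h.1, mod_cast h.2, by simp⟩⟩

end CardEquiv

/-- If one of the sizes is finite, choose a subset of that size and cancel. If both are infinite, an
infinite set splits into two equipotent halves. -/
theorem exists_subset_encard_split {B : Type*} {T : Set B} {f r : ℕ∞} (h : f + r = T.encard) :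
    ∃ T₁ ⊆ T, T₁.encard = f ∧ (T \ T₁).encard = r := by
  have key : ∀ f r : ℕ∞, f ≠ ⊤ → f + r = T.encard →
      ∃ T₁ ⊆ T, T₁.encard = f ∧ (T \ T₁).encard = r := by
    intro f r hf h
    obtain ⟨T₁, hT₁, hc⟩ := Set.exists_subset_encard_eq (h ▸ le_self_add : f ≤ T.encard)
    refine ⟨T₁, hT₁, hc, ?_⟩
    have := Set.encard_sdiff_add_encard_of_subset hT₁
    rw [← h, hc, add_comm] at this
    exact ENat.add_right_injective_of_ne_top hf this
  by_cases hf : f = ⊤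
  · by_cases hr : r = ⊤
    · subst hf hr
      have hT : T.Infinite := Set.encard_eq_top_iff.1 (by simp [← h])
      obtain ⟨t, u, htu, hd, hc⟩ := hT.exists_union_disjoint_cardinal_eq_of_infinite
      have htu' : t.Infinite ↔ u.Infinite := by
        rw [← Set.infinite_coe_iff, ← Set.infinite_coe_iff, Cardinal.infinite_iff, hc,
          ← Cardinal.infinite_iff]
      have ht : t.Infinite := by
        by_contra ht
        exact hT (htu ▸ (Set.not_infinite.1 ht).union (Set.not_infinite.1 fun hu => ht (htu'.2 hu)))
      refine ⟨t, htu ▸ Set.subset_union_left, ht.encard_eq, ?_⟩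
      rw [← htu, Set.union_sdiff_cancel_left hd.le_bot, (htu'.1 ht).encard_eq]
    · obtain ⟨T₁, hT, h₁, h₂⟩ := key r f hr (by rw [add_comm, h])
      exact ⟨T \ T₁, Set.sdiff_subset, h₂, by rw [Set.sdiff_sdiff_cancel_left hT, h₁]⟩
  · exact key f r hf h

/-- A colouring of `S` can be copied to a set `T` of the same size up to a large threshold. -/
theorem exists_coloring_on {A B C : Type*} [Inhabited C] (N : ℕ) (c : A → C)
    (F : Finset C) : ∀ (S : Set A) (T : Set B), (∀ a ∈ S, c a ∈ F) →
      CardEquiv (F.card * N + 1) S.encard T.encard →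
      ∃ c' : B → C, (∀ b ∈ T, c' b ∈ F) ∧
        ∀ k, CardEquiv N (S ∩ c ⁻¹' {k}).encard (T ∩ c' ⁻¹' {k}).encard := by
  classical
  induction F using Finset.induction_on with
  | empty =>
    intro S T hS h
    have hS' : S = ∅ := Set.eq_empty_of_forall_notMem fun a ha => by simpa using hS a ha
    -- The `+ 1` in the threshold serves here: without colours, `S` is empty, and `T` must be empty
    -- too.
    have hT : T = ∅ := by
      rw [← Set.encard_eq_zero, ← h.eq_zero_iff (by simp), hS', Set.encard_empty]
    subst hS' hT
    exact ⟨fun _ => default, by simp, fun k => .inl (by simp)⟩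
  | insert k F hk ih =>
    intro S T hS h
    -- Split off the class of colour `k`, which uses up `N` of the threshold.
    rw [Finset.card_insert_of_notMem hk, show (F.card + 1) * N + 1 = N + (F.card * N + 1) by ring,
      ← Set.encard_sdiff_add_encard_inter S (c ⁻¹' {k}), add_comm (Set.encard _)] at h
    obtain ⟨f, r, hfr, hf, hr⟩ := h.exists_split
    obtain ⟨T₁, hT₁, h₁, h₂⟩ := exists_subset_encard_split hfr
    obtain ⟨c', hc', hc''⟩ := ih (S \ c ⁻¹' {k}) (T \ T₁)
      (fun a ha => (Finset.mem_insert.1 (hS a ha.1)).resolve_left ha.2) (by rwa [h₂])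
    refine ⟨fun b => if b ∈ T₁ then k else c' b, fun b hb => ?_, fun j => ?_⟩
    · dsimp only
      split_ifs with hbT
      · simp
      · exact Finset.mem_insert_of_mem (hc' b ⟨hb, hbT⟩)
    · by_cases hj : j = k
      · subst hj
        convert hf using 1
        rw [← h₁]
        congr 1
        ext b
        simp only [Set.mem_inter_iff, Set.mem_preimage, Set.mem_singleton_iff]
        constructor
        · rintro ⟨hb, hb'⟩
          by_contra hbT
          rw [if_neg hbT] at hb'
          exact hk (hb' ▸ hc' b ⟨hb, hbT⟩)
        · exact fun hb => ⟨hT₁ hb, if_pos hb⟩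
      · convert hc'' j using 2
        · ext a
          simp only [Set.mem_inter_iff, Set.mem_preimage, Set.mem_singleton_iff, Set.mem_sdiff]
          grind
        · ext b
          simp only [Set.mem_inter_iff, Set.mem_preimage, Set.mem_singleton_iff, Set.mem_sdiff]
          grind

/-- If the fibres over a finite set agree up to a threshold, then so do preimages of subsets. -/
theorem cardEquiv_preimage {A B Q : Type*} [Finite Q] {N : ℕ} {f : A → Q} {g : B → Q}
    (h : ∀ q, CardEquiv N (f ⁻¹' {q}).encard (g ⁻¹' {q}).encard) (s : Set Q) :
    CardEquiv N (f ⁻¹' s).encard (g ⁻¹' s).encard := by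
  induction s, s.toFinite using Set.Finite.induction_on with
  | empty => exact .inl (by simp)
  | @insert q s hq _ ih =>
    have key : ∀ {X : Type _} (f : X → Q), (f ⁻¹' insert q s).encard =
        (f ⁻¹' {q}).encard + (f ⁻¹' s).encard := fun f => by
      rw [Set.insert_eq, Set.preimage_union, Set.encard_union_eq]
      exact Disjoint.preimage f (Set.disjoint_singleton_left.2 hq)
    rw [key, Set.insert_eq, Set.preimage_union, Set.encard_union_eq
      (Disjoint.preimage g (Set.disjoint_singleton_left.2 hq))]
    exact (h q).add ih

/-- Suppose that the fibres of `R` and `R'` have the same sizes up to a large threshold. Then every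
colouring on the one side has a counterpart on the other side. -/
theorem exists_coloring {A B P C : Type*} [Finite P] [Finite C] [Inhabited C] {N : ℕ} (hN : 1 ≤ N)
    {R : A → P} {R' : B → P} (c : A → C)
    (h : ∀ p, CardEquiv (Nat.card C * N + 1) (R ⁻¹' {p}).encard (R' ⁻¹' {p}).encard) :
    ∃ c' : B → C, (∀ b, ∃ a, R a = R' b ∧ c a = c' b) ∧
      ∀ k, CardEquiv N (c ⁻¹' {k}).encard (c' ⁻¹' {k}).encard := by
  classical
  have := Fintype.ofFinite C
  -- Copy the colouring separately over each fibre of `R`; the pairs (fibre, colour) then have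
  -- matching counts.
  choose d _ hd using fun p => exists_coloring_on N c Finset.univ (R ⁻¹' {p}) (R' ⁻¹' {p})
    (by simp) (by simpa [Nat.card_eq_fintype_card] using h p)
  have key : ∀ q : P × C, CardEquiv N ((fun a => (R a, c a)) ⁻¹' {q}).encard
      ((fun b => (R' b, d (R' b) b)) ⁻¹' {q}).encard := by
    rintro ⟨p, k⟩
    convert hd p k using 2
    · ext; simp
    · ext b
      simp only [Set.mem_preimage, Set.mem_singleton_iff, Prod.mk.injEq, Set.mem_inter_iff]
      exact and_congr_right fun h => by rw [h]
  refine ⟨fun b => d (R' b) b, fun b => ?_, fun k => ?_⟩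
  · have hne := ((key (R' b, d (R' b) b)).eq_zero_iff hN).not.2 (by
      rw [Set.encard_eq_zero]
      exact Set.Nonempty.ne_empty ⟨b, rfl⟩)
    obtain ⟨a, ha⟩ := Set.encard_ne_zero.1 hne
    exact ⟨a, congrArg Prod.fst ha, congrArg Prod.snd ha⟩
  · exact cardEquiv_preimage key {q | q.2 = k}

/-! ### The Feferman–Vaught theorem for restricted products -/

/-- A substructure of a product of structures, consisting of all families that satisfy the formula
`χ` at all but finitely many indices. -/
structure DefRestrictedProduct (L : FirstOrder.Language.{0, 0}) (χ : L.Formula Unit) where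
  /-- the restricted product -/
  Carrier : Type u
  /-- the index set -/
  Index : Type u
  /-- the factors -/
  Factor : Index → Type u
  [structCarrier : L.Structure Carrier]
  [structFactor : ∀ v, L.Structure (Factor v)]
  /-- the projections -/
  eval : ∀ v, Carrier →[L] Factor v
  eval_ext : ∀ a b, (∀ v, eval v a = eval v b) → a = b
  finite_not : ∀ a, {v | ¬ χ.Realize fun _ => eval v a}.Finite
  exists_lift : ∀ f : ∀ v, Factor v, {v | ¬ χ.Realize fun _ => f v}.Finite →
    ∃ a, ∀ v, eval v a = f v

namespace DefRestrictedProduct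

attribute [instance] structCarrier structFactor

variable {L : FirstOrder.Language.{0, 0}} {χ : L.Formula Unit}

/-- The set of those formulas in a family `ψ` that hold at the index `v`. -/
def truthSet (P : DefRestrictedProduct.{u} L χ) {ι α : Type*} {n : ℕ}
    (ψ : ι → L.BoundedFormula α n) (a : α → P.Carrier) (xs : Fin n → P.Carrier) (v : P.Index) :
    Set ι :=
  {i | (ψ i).Realize (P.eval v ∘ a) (P.eval v ∘ xs)}

variable (χ) in
/-- The truth of `φ` in restricted products depends only on the numbers, up to a threshold, of the
indices at which finitely many formulas have given truth values. -/
def IsDetermined {α : Type*} {n : ℕ} (φ : L.BoundedFormula α n) : Prop :=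
  ∃ (ι : Type) (_ : Finite ι) (ψ : ι → L.BoundedFormula α n) (N : ℕ),
    ∀ (P P' : DefRestrictedProduct.{u} L χ) (a : α → P.Carrier) (xs : Fin n → P.Carrier)
      (a' : α → P'.Carrier) (xs' : Fin n → P'.Carrier),
      (∀ s : Set ι, CardEquiv N (P.truthSet ψ a xs ⁻¹' {s}).encard
        (P'.truthSet ψ a' xs' ⁻¹' {s}).encard) →
      φ.Realize a xs → φ.Realize a' xs'

variable {α : Type*} {n : ℕ}

/-- Equality is tested componentwise, so it says that no index violates the equation; threshold 1
detects this. -/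
theorem isDetermined_equal (t₁ t₂ : L.Term (α ⊕ Fin n)) :
    IsDetermined.{u} χ (BoundedFormula.equal t₁ t₂) := by
  have key (P : DefRestrictedProduct.{u} L χ) (a : α → P.Carrier) (xs : Fin n → P.Carrier) :
      (BoundedFormula.equal t₁ t₂).Realize a xs ↔
        (P.truthSet (fun _ : Unit => BoundedFormula.equal t₁ t₂) a xs ⁻¹' {∅}).encard = 0 := by
    have h v : (Sum.elim (P.eval v ∘ a) (P.eval v ∘ xs)) = P.eval v ∘ Sum.elim a xs := by
      rw [Sum.comp_elim]
    simp only [Set.encard_eq_zero, Set.eq_empty_iff_forall_notMem, Set.mem_preimage, truthSet,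
      Set.mem_singleton_iff, Set.mem_ofPred_eq, BoundedFormula.Realize, h, HomClass.realize_term]
    constructor
    · intro h v hv
      exact hv () (congrArg _ h)
    · intro h
      refine P.eval_ext _ _ fun v => ?_
      by_contra hv
      exact h v fun _ => hv
  refine ⟨Unit, inferInstance, fun _ => .equal t₁ t₂, 1, fun P P' a xs a' xs' h hφ => ?_⟩
  rw [key] at hφ ⊢
  exact ((h ∅).eq_zero_iff le_rfl).1 hφ

/-- The premise has to be transferred backwards, from `P'` to `P`; this is possible because the
definition quantifies over all ordered pairs of products. -/
theorem IsDetermined.imp {φ₁ φ₂ : L.BoundedFormula α n} (h₁ : IsDetermined.{u} χ φ₁)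
    (h₂ : IsDetermined.{u} χ φ₂) : IsDetermined.{u} χ (φ₁.imp φ₂) := by
  obtain ⟨ι₁, _, ψ₁, N₁, h₁⟩ := h₁
  obtain ⟨ι₂, _, ψ₂, N₂, h₂⟩ := h₂
  refine ⟨ι₁ ⊕ ι₂, inferInstance, Sum.elim ψ₁ ψ₂, max N₁ N₂,
    fun P P' a xs a' xs' h hφ h' => ?_⟩
  refine h₂ P P' a xs a' xs' (fun s => ?_) (hφ (h₁ P' P a' xs' a xs (fun s => ?_) h'))
  · exact (cardEquiv_preimage h {t | Sum.inr ⁻¹' t = s}).mono (le_max_right _ _)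
  · exact ((cardEquiv_preimage h {t | Sum.inl ⁻¹' t = s}).mono (le_max_left _ _)).symm

/-- The formulas `ψ`, together with the formula `χ` for the last variable. -/
def withRestriction (χ : L.Formula Unit) {ι : Type*} (ψ : ι → L.BoundedFormula α (n + 1)) :
    Option ι → L.BoundedFormula α (n + 1)
  | none => BoundedFormula.relabel (n := n + 1) (fun _ => Sum.inr (Fin.last n)) χ
  | some i => ψ i

theorem realize_withRestriction_none {ι : Type*} (ψ : ι → L.BoundedFormula α (n + 1)) {M : Type*}
    [L.Structure M] (a : α → M) (xs : Fin n → M) (y : M) :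
    (withRestriction χ ψ none).Realize a (Fin.snoc xs y : Fin (n + 1) → M) ↔
      χ.Realize fun _ => y := by
  rw [withRestriction, Formula.Realize]
  refine (BoundedFormula.realize_relabel (m := n + 1) (n := 0)).trans ?_
  rw [iff_eq_eq]
  congr 1
  · ext
    simp
  · exact Subsingleton.elim _ _

open Classical in
/-- There is a value of the last variable for which exactly the formulas in `s` hold. -/
noncomputable def exPattern {ι : Type} [Finite ι] (ψ : ι → L.BoundedFormula α (n + 1)) (s : Set ι) :
    L.BoundedFormula α n :=
  (BoundedFormula.iInf fun i => if i ∈ s then ψ i else (ψ i).not).ex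

theorem realize_exPattern {ι : Type} [Finite ι] (ψ : ι → L.BoundedFormula α (n + 1)) (s : Set ι)
    {M : Type*} [L.Structure M] (a : α → M) (xs : Fin n → M) :
    (exPattern ψ s).Realize a xs ↔
      ∃ y : M, {i | (ψ i).Realize a (Fin.snoc xs y : Fin (n + 1) → M)} = s := by
  rw [exPattern, BoundedFormula.realize_ex]
  refine exists_congr fun y => ?_
  rw [BoundedFormula.realize_iInf, Set.ext_iff]
  refine forall_congr' fun i => ?_
  by_cases hi : i ∈ s <;> simp [hi]

/-- Given `b'` in `P'`, an element `b` of `P` is built whose patterns have the same counts; then `φ`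
passes from `b` to `b'`. That a pattern is attainable at an index is itself a formula, `exPattern`,
and these formulas are the ones to be counted. -/
theorem IsDetermined.all {φ : L.BoundedFormula α (n + 1)} (h : IsDetermined.{u} χ φ) :
    IsDetermined.{u} χ φ.all := by
  obtain ⟨ι, _, ψ, N, h⟩ := h
  -- The colours are the subsets of `Option ι`. The threshold is `N + 1` because `exists_coloring`
  -- needs a positive one.
  refine ⟨Set (Option ι), inferInstance, exPattern (withRestriction χ ψ),
    Nat.card (Set (Option ι)) * (N + 1) + 1, fun P P' a xs a' xs' hR hφ b' => ?_⟩
  have snoc (Q : DefRestrictedProduct.{u} L χ) (v) (xs : Fin n → Q.Carrier) (b : Q.Carrier) :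
      Q.eval v ∘ (Fin.snoc xs b : Fin (n + 1) → Q.Carrier) =
        Fin.snoc (Q.eval v ∘ xs) (Q.eval v b) := Fin.comp_snoc _ _ _
  obtain ⟨c, hc, hcN⟩ := exists_coloring (N := N + 1) (by omega)
    (P'.truthSet (withRestriction χ ψ) a' (Fin.snoc xs' b')) fun s => (hR s).symm
  -- The colour of `v` occurs at an index `v'` of `P'` with the same attainable patterns, so it is
  -- attainable at `v`.
  have hy v : ∃ y : P.Factor v, {i | (withRestriction χ ψ i).Realize (P.eval v ∘ a)
      (Fin.snoc (P.eval v ∘ xs) y : Fin (n + 1) → P.Factor v)} = c v := by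
    obtain ⟨v', hv', hv''⟩ := hc v
    have : c v ∈ P'.truthSet (exPattern (withRestriction χ ψ)) a' xs' v' := by
      rw [truthSet, Set.mem_ofPred_eq, realize_exPattern]
      exact ⟨P'.eval v' b', by rw [← hv'', truthSet, snoc]⟩
    rw [hv', truthSet, Set.mem_ofPred_eq, realize_exPattern] at this
    exact this
  choose f hf using hy
  have hχ v : χ.Realize (fun _ => f v) ↔ none ∈ c v := by
    rw [← hf, Set.mem_ofPred_eq, realize_withRestriction_none]
  have hχ' v : χ.Realize (fun _ => P'.eval v b') ↔
      none ∈ P'.truthSet (withRestriction χ ψ) a' (Fin.snoc xs' b') v := by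
    rw [truthSet, Set.mem_ofPred_eq, snoc, realize_withRestriction_none]
  -- The colour records through `none` whether χ holds, and matching counts preserve finiteness.
  have hfin : {v | ¬ χ.Realize fun _ => f v}.Finite := by
    have := P'.finite_not b'
    simp only [hχ, hχ'] at this ⊢
    rw [← Set.encard_ne_top_iff] at this ⊢
    exact (cardEquiv_preimage hcN {t | none ∉ t}).eq_top_iff.not.1 this
  obtain ⟨b, hb⟩ := P.exists_lift f hfin
  refine h P P' a (Fin.snoc xs b) a' (Fin.snoc xs' b') (fun s => ?_) (hφ b)
  have hcb : c = P.truthSet (withRestriction χ ψ) a (Fin.snoc xs b) := by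
    ext1 v
    rw [truthSet, snoc, hb, hf]
  rw [hcb] at hcN
  exact ((cardEquiv_preimage hcN {t | some ⁻¹' t = s}).mono (Nat.le_succ N)).symm

/-- The Feferman–Vaught theorem for restricted products. -/
theorem isDetermined [L.IsAlgebraic] (φ : L.BoundedFormula α n) : IsDetermined.{u} χ φ := by
  induction φ with
  | falsum => exact ⟨Empty, inferInstance, Empty.elim, 0, fun _ _ _ _ _ _ _ h => h⟩
  | equal t₁ t₂ => exact isDetermined_equal t₁ t₂
  | rel R => exact isEmptyElim R
  | imp _ _ h₁ h₂ => exact h₁.imp h₂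
  | all _ h => exact h.all

open Classical in
/-- Exactly the formulas in `s` hold. -/
noncomputable def pattern {ι : Type} [Finite ι] (ψ : ι → L.Formula α) (s : Set ι) : L.Formula α :=
  Formula.iInf fun i => if i ∈ s then ψ i else (ψ i).not

theorem realize_pattern {ι : Type} [Finite ι] (ψ : ι → L.Formula α) (s : Set ι)
    {M : Type*} [L.Structure M] (a : α → M) :
    (pattern ψ s).Realize a ↔ {i | (ψ i).Realize a} = s := by
  rw [pattern, Formula.realize_iInf, Set.ext_iff]
  refine forall_congr' fun i => ?_
  by_cases hi : i ∈ s <;> simp [hi]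

/-- The truth of a formula depends only on the numbers, up to a threshold, of the
indices at which finitely many formulas hold. -/
theorem exists_formulas_determining [L.IsAlgebraic] (χ : L.Formula Unit) (φ : L.Formula α) :
    ∃ (ι : Type) (_ : Finite ι) (ψ : ι → L.Formula α) (N : ℕ),
      ∀ (P P' : DefRestrictedProduct.{u} L χ) (a : α → P.Carrier) (a' : α → P'.Carrier),
        (∀ i, CardEquiv N {v | (ψ i).Realize (P.eval v ∘ a)}.encard
          {v | (ψ i).Realize (P'.eval v ∘ a')}.encard) →
        (φ.Realize a ↔ φ.Realize a') := by
  obtain ⟨ι, _, ψ, N, h⟩ := isDetermined.{u} (χ := χ) φ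
  refine ⟨Set ι, inferInstance, pattern ψ, N, fun P P' a a' hN => ?_⟩
  have key (Q : DefRestrictedProduct.{u} L χ) (a : α → Q.Carrier) (s : Set ι) :
      {v | (pattern ψ s).Realize (Q.eval v ∘ a)} = Q.truthSet ψ a default ⁻¹' {s} := by
    ext v
    rw [Set.mem_ofPred_eq, realize_pattern]
    simp only [truthSet, Formula.Realize, Set.mem_preimage, Set.mem_singleton_iff,
      Subsingleton.elim (Q.eval v ∘ default) default]
  simp only [key] at hN
  exact ⟨h P P' a _ a' _ hN, h P' P a' _ a _ fun s => (hN s).symm⟩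

end DefRestrictedProduct

/-! ### A uniform definition of valuation rings -/

/-- In a complete ultrametric field in which `2` is a unit, `1 + x` is a square if `‖x‖ < 1`. -/
theorem isSquare_one_add_of_norm_lt_one {F : Type*} [NormedField F] [IsUltrametricDist F]
    [CompleteSpace F] (h2 : ‖(2 : F)‖ = 1) {x : F} (hx : ‖x‖ < 1) : IsSquare (1 + x) := by
  have h20 : (2 : F) ≠ 0 := norm_ne_zero_iff.1 (by rw [h2]; exact one_ne_zero)
  -- A fixed point `y` satisfies `(1 + y)² = 1 + x`; on the ball of radius `‖x‖` the map contracts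
  -- by the factor `‖x‖`.
  let f : F → F := fun y => (x - y * y) / 2
  have hf : Set.MapsTo f (Metric.closedBall 0 ‖x‖) (Metric.closedBall 0 ‖x‖) := by
    intro y hy
    rw [mem_closedBall_zero_iff] at hy ⊢
    simp only [f, norm_div, h2, div_one]
    rw [sub_eq_add_neg]
    refine (IsUltrametricDist.norm_add_le_max _ _).trans (max_le le_rfl ?_)
    rw [norm_neg, norm_mul]
    nlinarith [norm_nonneg y, norm_nonneg x]
  have hc : ContractingWith ⟨‖x‖, norm_nonneg x⟩ (hf.restrict f _ _) := by
    refine ⟨hx, LipschitzWith.of_dist_le_mul fun y z => ?_⟩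
    obtain ⟨y, hy⟩ := y
    obtain ⟨z, hz⟩ := z
    rw [mem_closedBall_zero_iff] at hy hz
    change dist (f y) (f z) ≤ ‖x‖ * dist y z
    rw [dist_eq_norm, dist_eq_norm,
      show f y - f z = -((y + z) * (y - z)) / 2 by simp only [f]; ring, norm_div, h2, div_one,
      norm_neg, norm_mul]
    exact mul_le_mul_of_nonneg_right ((IsUltrametricDist.norm_add_le_max _ _).trans
      (max_le hy hz)) (norm_nonneg _)
  obtain ⟨y, -, hy, -⟩ := hc.exists_fixedPoint' Metric.isClosed_closedBall.isComplete hf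
    (x := 0) (by simp) (edist_ne_top _ _)
  refine ⟨1 + y, ?_⟩
  have hy' : (x - y * y) / 2 = y := hy
  field_simp at hy'
  linear_combination hy'

/-- `x` lies in a proper subset of the form `{y | 1 + t * y * y is a square}` that is closed under
multiplication. In a complete discretely valued field in which `2` is a unit, this says that `x` is
integral. -/
def InSquareRing {F : Type*} [CommRing F] (x : F) : Prop :=
  ∃ t : F, (∀ y z : F, IsSquare (1 + t * y * y) → IsSquare (1 + t * z * z) →
      IsSquare (1 + t * (y * z) * (y * z))) ∧
    (∃ z : F, ¬ IsSquare (1 + t * z * z)) ∧ IsSquare (1 + t * x * x)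

/-- The set defined by `t` contains all sufficiently small elements. If it contained some `x` with
`‖x‖ > 1`, it would contain the powers of `x`, hence every `z = (z / x ^ m) * x ^ m`, and would not
be proper. -/
theorem norm_le_one_of_inSquareRing {F : Type*} [NormedField F] [IsUltrametricDist F]
    [CompleteSpace F] (h2 : ‖(2 : F)‖ = 1) {x : F} (hx : InSquareRing x) : ‖x‖ ≤ 1 := by
  obtain ⟨t, hmul, ⟨z, hz⟩, hxt⟩ := hx
  by_contra! h
  have hx0 : x ≠ 0 := norm_pos_iff.1 (one_pos.trans h)
  have hpow : ∀ k : ℕ, IsSquare (1 + t * x ^ (k + 1) * x ^ (k + 1)) := by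
    intro k
    induction k with
    | zero => simpa using hxt
    | succ k ih => simpa only [pow_succ _ (k + 1)] using hmul _ _ ih hxt
  obtain ⟨k, hk⟩ := pow_unbounded_of_one_lt ‖t * z * z‖ h
  refine hz ?_
  have hlt : ‖t * (z / x ^ (k + 1)) * (z / x ^ (k + 1))‖ < 1 := by
    rw [show t * (z / x ^ (k + 1)) * (z / x ^ (k + 1)) = t * z * z / (x ^ (k + 1) * x ^ (k + 1)) by
      field_simp, norm_div, div_lt_one (norm_pos_iff.2 (by positivity)), norm_mul (x ^ _), norm_pow]
    have h1 : ‖x‖ ^ k ≤ ‖x‖ ^ (k + 1) := pow_le_pow_right₀ h.le k.le_succ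
    have h2 : 1 ≤ ‖x‖ ^ (k + 1) := one_le_pow₀ h.le
    nlinarith
  have := hmul _ _ (isSquare_one_add_of_norm_lt_one h2 hlt) (hpow k)
  rwa [div_mul_cancel₀ _ (pow_ne_zero _ hx0)] at this

/-- A parity argument: if `‖x‖ > 1`, the term `ϖ x²` dominates, and a square root `y` would give `‖y
/ x‖² = ‖ϖ‖`, although no norm lies strictly between `‖ϖ‖` and `1`. -/
theorem isSquare_one_add_uniformizer_iff {F : Type*} [NormedField F] [IsUltrametricDist F]
    [CompleteSpace F] (h2 : ‖(2 : F)‖ = 1) {ϖ : F} (h0 : ϖ ≠ 0) (h1 : ‖ϖ‖ < 1)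
    (hϖ : ∀ y : F, ‖y‖ < 1 → ‖y‖ ≤ ‖ϖ‖) (x : F) :
    IsSquare (1 + ϖ * x * x) ↔ ‖x‖ ≤ 1 := by
  have hpos := norm_pos_iff.2 h0
  constructor
  · rintro ⟨y, hy⟩
    by_contra! h
    have hx0 : 0 < ‖x‖ := one_pos.trans h
    have hx := hϖ x⁻¹ (by rw [norm_inv]; exact inv_lt_one_of_one_lt₀ h)
    rw [norm_inv, inv_le_iff_one_le_mul₀ hx0] at hx
    have hbig : ‖(1 : F)‖ < ‖ϖ * x * x‖ := by
      rw [norm_one, norm_mul, norm_mul]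
      nlinarith
    have hn : ‖y‖ * ‖y‖ = ‖ϖ‖ * ‖x‖ * ‖x‖ := by
      rw [← norm_mul, ← hy, IsUltrametricDist.norm_add_eq_max_of_norm_ne_norm hbig.ne,
        max_eq_right hbig.le, norm_mul, norm_mul]
    have hq : ‖y / x‖ * ‖y / x‖ = ‖ϖ‖ := by
      rw [norm_div, div_mul_div_comm, hn]
      field_simp
    have hq1 : ‖y / x‖ < 1 := by
      by_contra! h
      nlinarith
    have := hϖ _ hq1
    nlinarith [norm_nonneg (y / x)]
  · intro hx
    rw [mul_assoc]
    refine isSquare_one_add_of_norm_lt_one h2 ?_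
    rw [norm_mul, norm_mul]
    have := mul_le_one₀ hx (norm_nonneg x) hx
    nlinarith

theorem inSquareRing_iff {F : Type*} [NormedField F] [IsUltrametricDist F]
    [CompleteSpace F] (h2 : ‖(2 : F)‖ = 1) {ϖ : F} (h0 : ϖ ≠ 0) (h1 : ‖ϖ‖ < 1)
    (hϖ : ∀ y : F, ‖y‖ < 1 → ‖y‖ ≤ ‖ϖ‖) (x : F) : InSquareRing x ↔ ‖x‖ ≤ 1 := by
  refine ⟨norm_le_one_of_inSquareRing h2, fun hx => ⟨ϖ, ?_, ⟨ϖ⁻¹, ?_⟩, ?_⟩⟩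
  · intro y z
    simp only [isSquare_one_add_uniformizer_iff h2 h0 h1 hϖ, norm_mul]
    exact fun hy hz => mul_le_one₀ hy (norm_nonneg z) hz
  · rw [isSquare_one_add_uniformizer_iff h2 h0 h1 hϖ, norm_inv, not_le]
    exact (one_lt_inv₀ (norm_pos_iff.2 h0)).2 h1
  · exact (isSquare_one_add_uniformizer_iff h2 h0 h1 hϖ x).2 hx

/-! ### The integrality criterion as a ring formula -/

section Formula

/-- `1 + t * y * y` is a square. -/
def squareFormula {α : Type*} {n : ℕ} (t y : Language.ring.Term (α ⊕ Fin n)) :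
    Language.ring.BoundedFormula α n :=
  (BoundedFormula.equal ((1 + t * y * y).relabel (Sum.map id Fin.castSucc))
    (Term.var (Sum.inr (Fin.last n)) * Term.var (Sum.inr (Fin.last n)))).ex

theorem realize_squareFormula {α : Type*} {n : ℕ} (t y : Language.ring.Term (α ⊕ Fin n))
    {R : Type*} [CommRing R] [Ring.CompatibleRing R] (v : α → R) (xs : Fin n → R) :
    (squareFormula t y).Realize v xs ↔
      IsSquare (1 + t.realize (Sum.elim v xs) * y.realize (Sum.elim v xs) *
        y.realize (Sum.elim v xs)) := by
  have (w : R) : Sum.elim v (Fin.snoc xs w : Fin (n + 1) → R) ∘ Sum.map id Fin.castSucc =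
      Sum.elim v xs := by
    ext (i | i) <;> simp
  simp [squareFormula, BoundedFormula.Realize, IsSquare, this]

/-- The formula that expresses `InSquareRing`. -/
def squareRingFormula : Language.ring.Formula Unit :=
  BoundedFormula.ex <|
    (BoundedFormula.all <| BoundedFormula.all <|
      (squareFormula (n := 3) (.var (.inr 0)) (.var (.inr 1))).imp <|
      (squareFormula (.var (.inr 0)) (.var (.inr 2))).imp <|
      squareFormula (.var (.inr 0)) (.var (.inr 1) * .var (.inr 2))) ⊓
    ((BoundedFormula.ex <| (squareFormula (n := 2) (.var (.inr 0)) (.var (.inr 1))).not) ⊓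
      squareFormula (.var (.inr 0)) (.var (.inl ())))

theorem ringSat_squareRingFormula {R : Type*} [CommRing R] (x : R) :
    RingSat squareRingFormula (fun _ => x) ↔ InSquareRing x := by
  let := FirstOrder.Ring.compatibleRingOfRing R
  change Formula.Realize _ _ ↔ _
  rw [Formula.Realize, squareRingFormula]
  simp only [BoundedFormula.realize_ex, BoundedFormula.realize_all, BoundedFormula.realize_inf,
    BoundedFormula.realize_imp, BoundedFormula.realize_not, realize_squareFormula, InSquareRing,
    FirstOrder.Ring.realize_mul, Term.realize_var, Sum.elim_inr, Sum.elim_inl]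
  rfl

end Formula

/-! ### Completions at primes not above 2 -/

section NumberField

variable {K : Type u} [Field K] [NumberField K]

theorem adicCompletion_inSquareRing_iff (p : HeightOneSpectrum (𝓞 K)) (h2 : (2 : 𝓞 K) ∉ p.asIdeal)
    (x : p.adicCompletion K) : InSquareRing x ↔ x ∈ p.adicCompletionIntegers K := by
  obtain ⟨π, hπ⟩ := p.valuation_exists_uniformizer K
  have hv : Valued.v (π : p.adicCompletion K) = WithZero.exp (-1 : ℤ) :=
    (p.valuedAdicCompletion_eq_valuation' π).trans hπ
  have h0 : (π : p.adicCompletion K) ≠ 0 := by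
    rw [← (Valued.v (R := p.adicCompletion K)).ne_zero_iff, hv]
    exact WithZero.exp_ne_zero
  rw [HeightOneSpectrum.mem_adicCompletionIntegers, ← Valued.toNormedField.norm_le_one_iff]
  refine inSquareRing_iff ?_ h0 ?_ (fun y hy => ?_) x
  · have := (NumberField.FinitePlace.norm_eq_one_iff_notMem K p 2).2 h2
    rwa [map_ofNat, map_ofNat] at this
  · rw [Valued.toNormedField.norm_lt_one_iff, hv, ← WithZero.exp_zero]
    exact WithZero.exp_lt_exp.2 (by norm_num)
  · rw [← div_le_one (norm_pos_iff.2 h0), ← norm_div]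
    rw [Valued.toNormedField.norm_lt_one_iff] at hy
    refine Valued.toNormedField.norm_le_one_iff.2 ?_
    rw [map_div₀, hv]
    refine div_le_one_of_le₀ ?_ zero_le
    rcases eq_or_ne (Valued.v y) 0 with h | h
    · rw [h]
      exact zero_le
    · rw [← WithZero.exp_log h, ← WithZero.exp_zero, WithZero.exp_lt_exp] at hy
      rw [← WithZero.exp_log h, WithZero.exp_le_exp]
      omega

theorem finite_two_mem : {p : HeightOneSpectrum (𝓞 K) | (2 : 𝓞 K) ∈ p.asIdeal}.Finite := by
  have : (Ideal.span {(2 : 𝓞 K)}) ≠ 0 := by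
    simp
  refine (Ideal.finite_factors this).subset fun p hp => ?_
  exact Ideal.dvd_span_singleton.2 hp

end NumberField

/-! ### Ring homomorphisms and formulas -/

/-- A ring homomorphism as a homomorphism of structures for the language of rings. -/
def RingHom.toLanguageHom {R S : Type*} [CommRing R] [CommRing S] [Ring.CompatibleRing R]
    [Ring.CompatibleRing S] (f : R →+* S) : R →[Language.ring] S where
  toFun := f
  map_fun' g x := by cases g <;> simp
  map_rel' r := isEmptyElim r

theorem ringSat_comp_ringEquiv {R S α : Type*} [CommRing R] [CommRing S] (f : R ≃+* S)
    (φ : Language.ring.Formula α) (a : α → R) : RingSat φ (f ∘ a) ↔ RingSat φ a := by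
  let := FirstOrder.Ring.compatibleRingOfRing R
  let := FirstOrder.Ring.compatibleRingOfRing S
  exact StrongHomClass.realize_formula (Ring.languageEquivEquivRingEquiv.symm f) φ

/-- The projection of a ring `R` onto `eR`. -/
def toCornerHom {R : Type*} [CommRing R] (e : Idem R) : R →+* e.2.Corner where
  toFun := toCorner e
  map_zero' := Subtype.ext (by change (e : R) * 0 * e = 0; simp)
  map_one' := Subtype.ext (by change (e : R) * 1 * e = e; rw [mul_one, e.2.eq])
  map_add' x y := Subtype.ext
    (by change (e : R) * (x + y) * e = e * x * e + e * y * e; ring)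
  map_mul' x y := Subtype.ext
    (by
      change (e : R) * (x * y) * e = e * x * e * (e * y * e)
      linear_combination (-(x * y * e * (e + 1))) * e.2.eq)

theorem toCorner_surjective {R : Type*} [CommRing R] (e : Idem R) :
    Function.Surjective (toCorner e) := by
  rintro ⟨_, x, rfl⟩
  exact ⟨x, rfl⟩

theorem toCorner_eq_iff {R : Type*} [CommRing R] (e : Idem R) (x y : R) :
    toCorner e x = toCorner e y ↔ e * x = e * y := by
  have h (x : R) : (e : R) * x * e = e * x := by linear_combination x * e.2.eq
  refine Subtype.ext_iff.trans ?_
  change (e : R) * x * e = e * y * e ↔ _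
  rw [h, h]

/-- Multiplication by `e` maps `R` onto `eR`, so quantifiers over `eR` may range over `R`; only
equations change, from `s = t` to `e s = e t`. -/
theorem exists_relativize_bounded {α : Type*} {n : ℕ} (ψ : Language.ring.BoundedFormula α n) :
    ∃ θ : Language.ring.BoundedFormula (α ⊕ Unit) n, ∀ (R : Type u) [CommRing R]
      (e : Idem R) (a : α → R) (xs : Fin n → R),
      letI := FirstOrder.Ring.compatibleRingOfRing R
      letI := FirstOrder.Ring.compatibleRingOfRing e.2.Corner
      θ.Realize (Sum.elim a fun _ => (e : R)) xs ↔
        ψ.Realize (toCorner e ∘ a) (toCorner e ∘ xs) := by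
  induction ψ with
  | falsum => exact ⟨⊥, fun R _ e a xs => Iff.rfl⟩
  | @equal n t₁ t₂ =>
    refine ⟨.equal (.var (.inl (.inr ())) * t₁.relabel (Sum.map Sum.inl id))
      (.var (.inl (.inr ())) * t₂.relabel (Sum.map Sum.inl id)), fun R _ e a xs => ?_⟩
    let := FirstOrder.Ring.compatibleRingOfRing R
    let := FirstOrder.Ring.compatibleRingOfRing e.2.Corner
    have h : Sum.elim (toCorner e ∘ a) (toCorner e ∘ xs) =
      (toCornerHom e).toLanguageHom ∘ Sum.elim a xs := (Sum.comp_elim _ _ _).symm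
    have h' : Sum.elim (Sum.elim a fun _ : Unit => (e : R)) xs ∘ Sum.map Sum.inl id =
        Sum.elim a xs := by
      ext (i | i) <;> rfl
    change Term.realize _ _ = Term.realize _ _ ↔ Term.realize _ _ = Term.realize _ _
    rw [h, HomClass.realize_term, HomClass.realize_term]
    simp only [FirstOrder.Ring.realize_mul, Term.realize_relabel, h', Term.realize_var,
      Sum.elim_inl, Sum.elim_inr]
    exact (toCorner_eq_iff e _ _).symm
  | rel r => exact isEmptyElim r
  | imp _ _ h₁ h₂ =>
    obtain ⟨θ₁, h₁⟩ := h₁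
    obtain ⟨θ₂, h₂⟩ := h₂
    exact ⟨θ₁.imp θ₂, fun R _ e a xs => imp_congr (h₁ R e a xs) (h₂ R e a xs)⟩
  | @all n _ h =>
    obtain ⟨θ, h⟩ := h
    refine ⟨θ.all, fun R _ e a xs => ?_⟩
    let := FirstOrder.Ring.compatibleRingOfRing R
    let := FirstOrder.Ring.compatibleRingOfRing e.2.Corner
    rw [BoundedFormula.realize_all, BoundedFormula.realize_all, (toCorner_surjective e).forall]
    refine forall_congr' fun y => ?_
    rw [h, Fin.comp_snoc]

/-- The truth of a formula in `eR` is expressed by a formula in `R`. -/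
theorem exists_relativize {α : Type*} (ψ : Language.ring.Formula α) :
    ∃ θ : Language.ring.Formula (α ⊕ Unit), ∀ (R : Type u) [CommRing R] (e : Idem R) (a : α → R),
      RingSat θ (Sum.elim a fun _ => (e : R)) ↔ RingSat ψ fun i => toCorner e (a i) := by
  obtain ⟨θ, h⟩ := exists_relativize_bounded.{u} ψ
  refine ⟨θ, fun R _ e a => ?_⟩
  refine (h R e a default).trans (iff_of_eq ?_)
  let := FirstOrder.Ring.compatibleRingOfRing e.2.Corner
  change BoundedFormula.Realize _ _ _ = BoundedFormula.Realize _ _ _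
  congr 1
  exact Subsingleton.elim _ _

/-! ### The adeles as a restricted product -/

section Adeles

variable {K : Type u} [Field K] [NumberField K]

/-- The completion of a number field at a place. -/
abbrev Place.Completion : Place K → Type u
  | .inl w => w.Completion
  | .inr p => p.adicCompletion K

noncomputable instance : ∀ v : Place K, Field (Place.Completion v)
  | .inl w => inferInstanceAs (Field w.Completion)
  | .inr p => inferInstanceAs (Field (p.adicCompletion K))

/-- The component of an adele at a place. -/
noncomputable def adeleEval : ∀ v : Place K, 𝔸[K] →+* Place.Completion v
  | .inl w =>
    { toFun := fun a => a.1 w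
      map_zero' := rfl
      map_one' := rfl
      map_add' := fun _ _ => rfl
      map_mul' := fun _ _ => rfl }
  | .inr p =>
    { toFun := fun a => a.2 p
      map_zero' := rfl
      map_one' := rfl
      map_add' := fun _ _ => rfl
      map_mul' := fun _ _ => rfl }

theorem adeleEval_ext {a b : 𝔸[K]} (h : ∀ v, adeleEval v a = adeleEval v b) : a = b :=
  adele_ext (fun w => h (.inl w)) fun p => h (.inr p)

theorem exists_adele (f : ∀ v : Place K, Place.Completion v)
    (hf : {p : HeightOneSpectrum (𝓞 K) | f (.inr p) ∉ p.adicCompletionIntegers K}.Finite) :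
    ∃ a : 𝔸[K], ∀ v, adeleEval v a = f v :=
  ⟨(fun w => f (.inl w), ⟨fun p => f (.inr p), hf⟩), fun v => by cases v <;> rfl⟩

theorem finite_not_integral (a : 𝔸[K]) :
    {p : HeightOneSpectrum (𝓞 K) | adeleEval (.inr p) a ∉ p.adicCompletionIntegers K}.Finite :=
  a.2.2

/-- `InSquareRing` defines the valuation ring at all but finitely many places. -/
theorem finite_inSquareRing_ne (f : ∀ v : Place K, Place.Completion v) :
    {v | ¬ InSquareRing (f v)}.Finite ↔
      {p : HeightOneSpectrum (𝓞 K) | f (.inr p) ∉ p.adicCompletionIntegers K}.Finite := by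
  have key : ∀ p : HeightOneSpectrum (𝓞 K), (2 : 𝓞 K) ∉ p.asIdeal →
      (InSquareRing (f (.inr p)) ↔ f (.inr p) ∈ p.adicCompletionIntegers K) :=
    fun p hp => adicCompletion_inSquareRing_iff p hp (f (.inr p))
  constructor
  · intro h
    -- Nothing is claimed at primes above 2; they are finitely many and do not affect finiteness.
    refine ((h.preimage Sum.inr_injective.injOn).union finite_two_mem).subset fun p hp => ?_
    by_cases h2 : (2 : 𝓞 K) ∈ p.asIdeal
    · exact .inr h2
    · exact .inl ((key p h2).not.2 hp)
  · intro h
    refine ((Set.finite_range Sum.inl).union ((h.union finite_two_mem).image Sum.inr)).subset ?_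
    rintro (w | p) hp
    · exact .inl ⟨w, rfl⟩
    · refine .inr ⟨p, ?_, rfl⟩
      by_cases h2 : (2 : 𝓞 K) ∈ p.asIdeal
      · exact .inr h2
      · exact .inl ((key p h2).not.1 hp)

variable (K) in
/-- The adele ring as a restricted product of structures for the language of rings. -/
noncomputable def adeleRestrictedProduct :
    DefRestrictedProduct.{u} Language.ring squareRingFormula :=
  letI := FirstOrder.Ring.compatibleRingOfRing 𝔸[K]
  letI (v : Place K) := FirstOrder.Ring.compatibleRingOfRing (Place.Completion v)
  { Carrier := 𝔸[K]
    Index := Place K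
    Factor := Place.Completion
    eval := fun v => (adeleEval v).toLanguageHom
    eval_ext := fun _ _ => adeleEval_ext
    finite_not := fun a => by
      have := (finite_inSquareRing_ne fun v => adeleEval v a).2 (finite_not_integral a)
      simp only [← ringSat_squareRingFormula] at this
      exact this
    exists_lift := fun f hf => exists_adele f ((finite_inSquareRing_ne f).1 (by
      simp only [← ringSat_squareRingFormula]
      exact hf)) }

/-- The places at whose completions a formula holds. -/
def satPlaces {α : Type*} (φ : Language.ring.Formula α) (a : α → 𝔸[K]) : Set (Place K) :=
  {v | RingSat φ fun i => adeleEval v (a i)}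

variable (K) in
/-- Idempotent adeles correspond to sets of places. -/
noncomputable def idemOrderIso : Set (Place K) ≃o Idem 𝔸[K] where
  toFun X := ⟨indicatorAdele X, isIdempotentElem_indicatorAdele X⟩
  invFun e := adeleSupport (e : 𝔸[K])
  left_inv X := adeleSupport_indicatorAdele X
  right_inv e := le_antisymm (idem_le_iff.2 (adeleSupport_indicatorAdele _).le)
    (idem_le_iff.2 (adeleSupport_indicatorAdele _).ge)
  map_rel_iff' := by
    intro X Y
    rw [idem_le_iff]
    exact iff_of_eq (congrArg₂ _ (adeleSupport_indicatorAdele X) (adeleSupport_indicatorAdele Y))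

theorem isAtom_idem_iff {e : Idem 𝔸[K]} : IsAtom e ↔ ∃ v, e = idemOrderIso K {v} := by
  rw [← (idemOrderIso K).symm.isAtom_iff, Set.isAtom_iff]
  simp only [OrderIso.symm_apply_eq]

theorem adeleEval_idemOrderIso_self (v : Place K) :
    adeleEval v (idemOrderIso K {v} : 𝔸[K]) = 1 := by
  cases v
  · exact if_pos rfl
  · exact if_pos rfl

theorem adeleEval_idemOrderIso_of_ne {v w : Place K} (h : w ≠ v) :
    adeleEval w (idemOrderIso K {v} : 𝔸[K]) = 0 := by
  cases w
  · exact if_neg h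
  · exact if_neg h

/-- The projection of `e_v 𝔸` to the completion at `v`. -/
noncomputable def cornerEval (v : Place K) : (idemOrderIso K {v}).2.Corner →+* Place.Completion v where
  toFun x := adeleEval v x.1
  map_zero' := map_zero _
  map_one' := adeleEval_idemOrderIso_self v
  map_add' x y := map_add (adeleEval v) x.1 y.1
  map_mul' x y := map_mul (adeleEval v) x.1 y.1

theorem cornerEval_toCorner (v : Place K) (a : 𝔸[K]) :
    cornerEval v (toCorner (idemOrderIso K {v}) a) = adeleEval v a := by
  change adeleEval v ((idemOrderIso K {v} : 𝔸[K]) * a * (idemOrderIso K {v} : 𝔸[K])) = _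
  simp [adeleEval_idemOrderIso_self]

/-- The ring `e_v 𝔸` is the completion at `v`. -/
noncomputable def cornerEquiv (v : Place K) :
    (idemOrderIso K {v}).2.Corner ≃+* Place.Completion v :=
  .ofBijective (cornerEval v) <| by
    classical
    constructor
    · rintro ⟨_, x, rfl⟩ ⟨_, y, rfl⟩ h
      refine Subtype.ext (adeleEval_ext fun w => ?_)
      by_cases hw : w = v
      · subst hw
        exact h
      · simp [adeleEval_idemOrderIso_of_ne hw]
    · intro y
      obtain ⟨a, ha⟩ := exists_adele (Function.update (0 : ∀ v : Place K, Place.Completion v) v y)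
        (((Set.finite_singleton v).preimage Sum.inr_injective.injOn).subset fun p hp => by
          by_contra h
          refine hp ?_
          rw [Function.update_of_ne h]
          exact zero_mem _)
      refine ⟨toCorner _ a, ?_⟩
      rw [cornerEval_toCorner, ha, Function.update_self]

theorem mem_satAtoms_iff {α : Type*} (φ : Language.ring.Formula α) (a : α → 𝔸[K]) (v : Place K) :
    idemOrderIso K {v} ∈ satAtoms φ a ↔ v ∈ satPlaces φ a := by
  refine (and_iff_right (isAtom_idem_iff.2 ⟨v, rfl⟩)).trans ?_
  rw [← ringSat_comp_ringEquiv (cornerEquiv v), satPlaces, Set.mem_ofPred_eq]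
  exact iff_of_eq (congrArg _ (funext fun i => cornerEval_toCorner v (a i)))

theorem satAtoms_eq_image {α : Type*} (φ : Language.ring.Formula α) (a : α → 𝔸[K]) :
    satAtoms φ a = (fun v => idemOrderIso K {v}) '' satPlaces φ a := by
  ext e
  constructor
  · intro he
    obtain ⟨v, rfl⟩ := isAtom_idem_iff.1 he.1
    exact ⟨v, (mem_satAtoms_iff φ a v).1 he, rfl⟩
  · rintro ⟨v, hv, rfl⟩
    exact (mem_satAtoms_iff φ a v).2 hv

theorem idemOrderIso_singleton_injective :
    Function.Injective fun v => idemOrderIso K {v} :=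
  (idemOrderIso K).injective.comp Set.singleton_injective

theorem adeleSupport_boolValue {α : Type*} (φ : Language.ring.Formula α) (a : α → 𝔸[K]) :
    adeleSupport (boolValue φ a : 𝔸[K]) = satPlaces φ a := by
  have h : boolValue φ a = idemOrderIso K (satPlaces φ a) := by
    refine (isLUB_boolValue φ a).unique ⟨?_, fun f hf => ?_⟩
    · rw [satAtoms_eq_image]
      rintro _ ⟨v, hv, rfl⟩
      exact (idemOrderIso K).monotone (Set.singleton_subset_iff.2 hv)
    · rw [← (idemOrderIso K).apply_symm_apply f, (idemOrderIso K).le_iff_le]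
      intro v hv
      have := hf ((mem_satAtoms_iff φ a v).2 hv)
      rw [← (idemOrderIso K).apply_symm_apply f, (idemOrderIso K).le_iff_le] at this
      exact this rfl
  rw [h]
  exact adeleSupport_indicatorAdele _

theorem isFin_boolValue_iff {α : Type*} (φ : Language.ring.Formula α) (a : α → 𝔸[K]) :
    IsFin (boolValue φ a) ↔ (satPlaces φ a).Finite := by
  rw [IsFin, adeleSupport_boolValue]

theorem hasAtoms_boolValue_iff {α : Type*} (φ : Language.ring.Formula α) (a : α → 𝔸[K]) (j : ℕ) :
    HasAtoms j (boolValue φ a) ↔ (j : ℕ∞) ≤ (satPlaces φ a).encard := by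
  have : {f : Idem 𝔸[K] | IsAtom f ∧ f ≤ boolValue φ a} =
      (fun v => idemOrderIso K {v}) '' satPlaces φ a := by
    ext f
    simp only [isAtom_idem_iff, Set.mem_ofPred_eq, Set.mem_image]
    constructor
    · rintro ⟨⟨v, rfl⟩, hv⟩
      rw [idem_le_iff, adeleSupport_boolValue] at hv
      exact ⟨v, hv ((adeleSupport_indicatorAdele _).ge rfl), rfl⟩
    · rintro ⟨v, hv, rfl⟩
      refine ⟨⟨v, rfl⟩, ?_⟩
      rw [idem_le_iff, adeleSupport_boolValue]
      exact (adeleSupport_indicatorAdele _).le.trans (Set.singleton_subset_iff.2 hv)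
  rw [HasAtoms, this, idemOrderIso_singleton_injective.encard_image]

end Adeles

/-! ### Defining `Fin` and `C_j` -/

section RingSat

variable {R α β : Type*} [CommRing R]

theorem ringSat_inf (φ ψ : Language.ring.Formula α) (a : α → R) :
    RingSat (φ ⊓ ψ) a ↔ RingSat φ a ∧ RingSat ψ a := by
  let := FirstOrder.Ring.compatibleRingOfRing R
  exact Formula.realize_inf

theorem ringSat_not (φ : Language.ring.Formula α) (a : α → R) :
    RingSat φ.not a ↔ ¬ RingSat φ a := by
  let := FirstOrder.Ring.compatibleRingOfRing R
  exact Formula.realize_not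

theorem ringSat_relabel (φ : Language.ring.Formula α) (g : α → β) (a : β → R) :
    RingSat (φ.relabel g) a ↔ RingSat φ (a ∘ g) := by
  let := FirstOrder.Ring.compatibleRingOfRing R
  exact Formula.realize_relabel

theorem ringSat_iExs [Finite β] (φ : Language.ring.Formula (α ⊕ β)) (a : α → R) :
    RingSat (φ.iExs β) a ↔ ∃ b : β → R, RingSat φ (Sum.elim a b) := by
  let := FirstOrder.Ring.compatibleRingOfRing R
  exact Formula.realize_iExs

theorem ringSat_iInf [Finite β] (φ : β → Language.ring.Formula α) (a : α → R) :
    RingSat (Formula.iInf φ) a ↔ ∀ b, RingSat (φ b) a := by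
  let := FirstOrder.Ring.compatibleRingOfRing R
  exact Formula.realize_iInf

theorem ringSat_equal (s t : α) (a : α → R) :
    RingSat (Term.equal (.var s) (.var t)) a ↔ a s = a t := by
  let := FirstOrder.Ring.compatibleRingOfRing R
  exact Formula.realize_equal

end RingSat

/-- `x` is a minimal nonzero idempotent. -/
def idemAtomFormula : Language.ring.Formula Unit :=
  (BoundedFormula.equal (.var (.inl ()) * .var (.inl ())) (.var (.inl ()))) ⊓
  ((BoundedFormula.equal (.var (.inl ())) 0).not ⊓
  BoundedFormula.all ((BoundedFormula.equal (.var (.inr 0) * .var (.inr 0)) (.var (.inr 0))).imp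
    ((BoundedFormula.equal (.var (.inr 0) * .var (.inl ())) (.var (.inr 0))).imp
    ((BoundedFormula.equal (.var (.inr 0)) (.var (.inl ()))).not.imp
      (BoundedFormula.equal (.var (.inr 0)) 0)))))

theorem ringSat_idemAtomFormula {R : Type*} [CommRing R] (e : R) :
    RingSat idemAtomFormula (fun _ => e) ↔ ∃ h : IsIdempotentElem e, IsAtom (⟨e, h⟩ : Idem R) := by
  have : RingSat idemAtomFormula (fun _ => e) ↔ e * e = e ∧ e ≠ 0 ∧
      ∀ f : R, f * f = f → f * e = f → f ≠ e → f = 0 := by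
    let := FirstOrder.Ring.compatibleRingOfRing R
    change Formula.Realize _ _ ↔ _
    rw [Formula.Realize, idemAtomFormula]
    simp only [BoundedFormula.realize_inf, BoundedFormula.Realize, FirstOrder.Ring.realize_mul,
      FirstOrder.Ring.realize_zero, Term.realize_var, Sum.elim_inr, Sum.elim_inl]
    rfl
  rw [this]
  constructor
  · rintro ⟨h, h0, hf⟩
    refine ⟨h, fun h' => h0 (congrArg Subtype.val h'), fun f hlt => ?_⟩
    exact Subtype.ext (hf f f.2 hlt.le fun h' => hlt.ne (Subtype.ext h'))
  · rintro ⟨h, h0, hf⟩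
    refine ⟨h, fun h' => h0 (Subtype.ext h'), fun f hff hfe hne => ?_⟩
    have hle : (⟨f, hff⟩ : Idem R) ≤ ⟨e, h⟩ := hfe
    exact congrArg Subtype.val (hf ⟨f, hff⟩ (hle.lt_of_ne fun h' => hne (congrArg Subtype.val h')))

theorem exists_satAtoms_formula {α : Type*} (ψ : Language.ring.Formula α) :
    ∃ θ : Language.ring.Formula (α ⊕ Unit), ∀ (R : Type u) [CommRing R] (a : α → R) (e : R),
      RingSat θ (Sum.elim a fun _ => e) ↔
        ∃ h : IsIdempotentElem e, (⟨e, h⟩ : Idem R) ∈ satAtoms ψ a := by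
  obtain ⟨θ, hθ⟩ := exists_relativize.{u} ψ
  refine ⟨idemAtomFormula.relabel Sum.inr ⊓ θ, fun R _ a e => ?_⟩
  rw [ringSat_inf, ringSat_relabel, Sum.elim_comp_inr, ringSat_idemAtomFormula,
    ← exists_and_right]
  exact exists_congr fun h => and_congr_right fun _ => hθ R ⟨e, h⟩ a

theorem natCast_le_encard_iff {X : Type*} (S : Set X) (j : ℕ) :
    (j : ℕ∞) ≤ S.encard ↔ ∃ f : Fin j → X, Function.Injective f ∧ ∀ i, f i ∈ S := by
  constructor
  · intro h
    obtain ⟨T, hT, hc⟩ := Set.exists_subset_encard_eq h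
    have hfin : T.Finite := Set.finite_of_encard_eq_coe hc
    have := hfin.to_subtype
    have e := Finite.equivFinOfCardEq (α := T) (n := j)
      (by rw [Nat.card_coe_set_eq, Set.ncard, hc, ENat.toNat_natCast])
    exact ⟨fun i => e.symm i, Subtype.val_injective.comp e.symm.injective,
      fun i => hT (e.symm i).2⟩
  · rintro ⟨f, hf, hS⟩
    calc (j : ℕ∞) = (Set.range f).encard := by
          rw [← Set.image_univ, hf.encard_image, Set.encard_univ]; simp
      _ ≤ S.encard := Set.encard_le_encard (Set.range_subset_iff.2 hS)

/-- The condition `C_j([[ψ(x)]])` is definable. -/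
theorem exists_hasAtoms_formula {α : Type*} (ψ : Language.ring.Formula α) (j : ℕ) :
    ∃ θ : Language.ring.Formula α, ∀ (K : Type u) [Field K] [NumberField K] (a : α → 𝔸[K]),
      RingSat θ a ↔ HasAtoms j (boolValue ψ a) := by
  obtain ⟨θ, hθ⟩ := exists_satAtoms_formula.{u} ψ
  refine ⟨(Formula.iExs (Fin j) ((Formula.iInf fun i : Fin j =>
    θ.relabel (Sum.map id fun _ => i)) ⊓ Formula.iInf fun p : {p : Fin j × Fin j // p.1 ≠ p.2} =>
      (Term.equal (.var (.inr p.1.1)) (.var (.inr p.1.2))).not)), fun K _ _ a => ?_⟩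
  rw [hasAtoms_boolValue_iff, ← idemOrderIso_singleton_injective.encard_image,
    ← satAtoms_eq_image, natCast_le_encard_iff, ringSat_iExs]
  simp only [ringSat_inf, ringSat_iInf, ringSat_relabel, ringSat_not, ringSat_equal, Sum.elim_inr]
  have key (b : Fin j → 𝔸[K]) (i : Fin j) :
      Sum.elim a b ∘ Sum.map id (fun _ : Unit => i) = Sum.elim a fun _ => b i := by
    ext (_ | _) <;> rfl
  simp only [key, hθ]
  constructor
  · rintro ⟨b, hb, hne⟩
    choose h hb using hb
    refine ⟨fun i => ⟨b i, h i⟩, fun i i' hi => ?_, hb⟩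
    by_contra hii
    exact hne ⟨(i, i'), hii⟩ (congrArg Subtype.val hi)
  · rintro ⟨f, hf, hS⟩
    exact ⟨fun i => (f i).1, fun i => ⟨(f i).2, hS i⟩,
      fun p h => p.2 (hf (Subtype.ext h))⟩

/-- These are the places where no adele can violate χ. At a prime not above 2, any non-integral
element violates it. -/
theorem finite_forall_inSquareRing (K : Type u) [Field K] [NumberField K] :
    {v : Place K | ∀ z : Place.Completion v, InSquareRing z}.Finite := by
  refine ((Set.finite_range Sum.inl).union (finite_two_mem.image Sum.inr)).subset ?_
  rintro (w | p) hp
  · exact .inl ⟨w, rfl⟩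
  · refine .inr ⟨p, ?_, rfl⟩
    by_contra h2
    obtain ⟨z, hz⟩ := p.valuedAdicCompletion_surjective K (WithZero.exp (1 : ℤ))
    have := (adicCompletion_inSquareRing_iff p h2 z).1 (hp z)
    rw [HeightOneSpectrum.mem_adicCompletionIntegers, hz, ← WithZero.exp_zero,
      WithZero.exp_le_exp] at this
    omega

/-- An adele violates χ at only finitely many places, and on a finite set of places it can be chosen
to violate χ wherever that is possible. This replaces finiteness by a quantifier over adeles. -/
theorem finite_satPlaces_iff {K : Type u} [Field K] [NumberField K] {α : Type*}
    (ψ : Language.ring.Formula α) (a : α → 𝔸[K]) :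
    (satPlaces ψ a).Finite ↔ ∃ y : 𝔸[K], ∀ v ∈ satPlaces ψ a, InSquareRing (adeleEval v y) →
      ∀ z : Place.Completion v, InSquareRing z := by
  classical
  constructor
  · intro h
    have hz (v : Place K) : ∃ z : Place.Completion v, InSquareRing z →
        ∀ z : Place.Completion v, InSquareRing z := by
      by_cases hv : ∀ z : Place.Completion v, InSquareRing z
      · exact ⟨0, fun _ => hv⟩
      · push Not at hv
        exact hv.imp fun z hz h => absurd h hz
    choose z hz using hz
    obtain ⟨y, hy⟩ := exists_adele (fun v => if v ∈ satPlaces ψ a then z v else 0)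
      ((h.preimage Sum.inr_injective.injOn).subset fun p hp => by
        by_contra hv
        refine hp ?_
        rw [if_neg (show Sum.inr p ∉ satPlaces ψ a from hv)]
        exact zero_mem _)
    refine ⟨y, fun v hv => ?_⟩
    rw [hy, if_pos hv]
    exact hz v
  · rintro ⟨y, hy⟩
    refine (((finite_inSquareRing_ne fun v => adeleEval v y).2 (finite_not_integral y)).union
      (finite_forall_inSquareRing K)).subset fun v hv => ?_
    by_cases h : InSquareRing (adeleEval v y)
    · exact .inr (hy v hv h)
    · exact .inl h

/-- The condition `Fin([[ψ(x)]])` is definable. -/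
theorem exists_isFin_formula {α : Type*} (ψ : Language.ring.Formula α) :
    ∃ θ : Language.ring.Formula α, ∀ (K : Type u) [Field K] [NumberField K] (a : α → 𝔸[K]),
      RingSat θ a ↔ IsFin (boolValue ψ a) := by
  -- `ψ'` holds at the places that refute the witness `y`: `ψ` holds, χ can fail, yet `y` satisfies
  -- χ.
  let ψ' : Language.ring.Formula (α ⊕ Unit) :=
    ψ.relabel Sum.inl ⊓ (squareRingFormula.relabel Sum.inr ⊓
      Formula.iExs Unit (squareRingFormula.relabel Sum.inr).not)
  have hψ' {R : Type u} [CommRing R] (a : α → R) (y : R) :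
      RingSat ψ' (Sum.elim a fun _ => y) ↔
        RingSat ψ a ∧ InSquareRing y ∧ ∃ z : R, ¬ InSquareRing z := by
    simp only [ψ', ringSat_inf, ringSat_relabel, ringSat_iExs, ringSat_not, Sum.elim_comp_inl,
      Sum.elim_comp_inr, ← ringSat_squareRingFormula]
    refine and_congr_right fun _ => and_congr_right fun _ => ⟨?_, ?_⟩
    · rintro ⟨b, hb⟩
      exact ⟨b (), hb⟩
    · rintro ⟨z, hz⟩
      exact ⟨fun _ => z, hz⟩
  obtain ⟨θ, hθ⟩ := exists_satAtoms_formula.{u} ψ'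
  refine ⟨Formula.iExs Unit (Formula.iExs Unit θ).not, fun K _ _ a => ?_⟩
  rw [isFin_boolValue_iff, finite_satPlaces_iff, ringSat_iExs,
    (Equiv.funUnique Unit 𝔸[K]).symm.surjective.exists]
  refine exists_congr fun y => ?_
  rw [ringSat_not, ringSat_iExs, (Equiv.funUnique Unit 𝔸[K]).symm.surjective.exists]
  change (¬ ∃ e : 𝔸[K], RingSat θ (Sum.elim (Sum.elim a fun _ => y) fun _ => e)) ↔ _
  simp only [hθ, satAtoms_eq_image]
  have hmem (v : Place K) : v ∈ satPlaces ψ' (Sum.elim a fun _ => y) ↔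
      v ∈ satPlaces ψ a ∧ InSquareRing (adeleEval v y) ∧
        ∃ z : Place.Completion v, ¬ InSquareRing z := by
    rw [satPlaces, Set.mem_ofPred_eq, satPlaces, Set.mem_ofPred_eq, ← hψ']
    refine iff_of_eq (congrArg _ (funext fun i => ?_))
    cases i <;> rfl
  constructor
  · intro h v hv hy z
    by_contra hz
    exact h ⟨_, (idemOrderIso K {v}).2, v, (hmem v).2 ⟨hv, hy, z, hz⟩, rfl⟩
  · rintro h ⟨e, he, v, hv, -⟩
    obtain ⟨hv, hy, z, hz⟩ := (hmem v).1 hv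
    exact hz (h v hv hy z)

/-! ### Quantifier elimination -/

theorem CardEquiv.of_le_iff {N : ℕ} {m n : ℕ∞} (h : m = ⊤ ↔ n = ⊤)
    (h' : ∀ j : ℕ, 1 ≤ j → j ≤ N → ((j : ℕ∞) ≤ m ↔ (j : ℕ∞) ≤ n)) : CardEquiv N m n := by
  by_cases hm : (N : ℕ∞) ≤ m ∧ (N : ℕ∞) ≤ n
  · exact .inr ⟨hm.1, hm.2, h⟩
  refine .inl ?_
  by_cases hmt : m = ⊤
  · rw [hmt, h.1 hmt]
  have hnt := h.not.1 hmt
  lift m to ℕ using hmt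
  lift n to ℕ using hnt
  norm_cast at hm h' ⊢
  -- Testing `j = m`, `j = n` and `j = N` suffices.
  have h₁ := h' m
  have h₂ := h' n
  have h₃ := h' N
  omega

theorem exists_boolValues_determining {α : Type*} (φ : Language.ring.Formula α) :
    ∃ l : ℕ, 1 ≤ l ∧ ∃ (ψ : Fin l → Language.ring.Formula α) (N : ℕ),
      ∀ (K : Type u) [Field K] [NumberField K] (a : α → 𝔸[K])
        (K' : Type u) [Field K'] [NumberField K'] (a' : α → 𝔸[K']),
        (∀ i, IsFin (boolValue (ψ i) a) ↔ IsFin (boolValue (ψ i) a')) →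
        (∀ i (j : Fin N), HasAtoms (j + 1) (boolValue (ψ i) a) ↔
          HasAtoms (j + 1) (boolValue (ψ i) a')) →
        RingSat φ a → RingSat φ a' := by
  obtain ⟨ι, _, ψ, N, h⟩ :=
    DefRestrictedProduct.exists_formulas_determining.{u} squareRingFormula φ
  obtain ⟨m, ⟨e⟩⟩ := Finite.exists_equiv_fin ι
  -- The dummy formula `⊥` ensures `l ≥ 1` when the family is empty.
  refine ⟨m + 1, by omega, Fin.cons ⊥ (ψ ∘ e.symm), N, fun K _ _ a K' _ _ a' hfin hatoms => ?_⟩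
  refine (h (adeleRestrictedProduct K) (adeleRestrictedProduct K') a a' fun i => ?_).1
  have hfin := hfin (e i).succ
  have hatoms := hatoms (e i).succ
  simp only [Fin.cons_succ, Function.comp_apply, Equiv.symm_apply_apply, isFin_boolValue_iff,
    hasAtoms_boolValue_iff] at hfin hatoms
  refine CardEquiv.of_le_iff ?_ fun j hj hjN => ?_
  · rw [Set.encard_eq_top_iff, Set.encard_eq_top_iff]
    exact hfin.not
  · have := hatoms ⟨j - 1, by omega⟩
    simp only [Nat.sub_add_cancel hj] at this
    exact this

/-- The sets `Q k` cut `X` into finitely many cells, and `D` is the union of the cells that it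
meets. -/
theorem BooleanSubalgebra.mem_of_forall_iff {X κ : Type*} [Finite κ] (B : BooleanSubalgebra (Set X))
    (Q : κ → Set X) (hQ : ∀ k, Q k ∈ B) (D : Set X)
    (h : ∀ x y, (∀ k, x ∈ Q k ↔ y ∈ Q k) → x ∈ D → y ∈ D) : D ∈ B := by
  classical
  have hD : D = ⨆ s ∈ {s : Set κ | ∃ x ∈ D, {k | x ∈ Q k} = s},
      ⨅ k, if k ∈ s then Q k else (Q k)ᶜ := by
    ext y
    simp only [Set.iSup_eq_iUnion, Set.iInf_eq_iInter, Set.mem_iUnion, Set.mem_iInter]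
    constructor
    · intro hy
      refine ⟨{k | y ∈ Q k}, ⟨y, hy, rfl⟩, fun k => ?_⟩
      by_cases hk : y ∈ Q k <;> simp [hk]
    · rintro ⟨_, ⟨x, hx, rfl⟩, hy⟩
      refine h x y (fun k => ?_) hx
      have := hy k
      by_cases hk : x ∈ Q k <;> simpa [hk] using this
  rw [hD]
  refine B.biSup_mem (Set.toFinite _) fun s _ => B.iInf_mem fun k => ?_
  split_ifs
  · exact hQ k
  · exact B.compl_mem (hQ k)

/-- A tuple of adeles of a number field. -/
structure AdeleTuple (n : ℕ) : Type (u + 1) where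
  /-- the number field -/
  K : Type u
  [field : Field K]
  [numberField : NumberField K]
  /-- the tuple -/
  val : Fin n → 𝔸[K]

attribute [instance] AdeleTuple.field AdeleTuple.numberField

/-- The classes of tuples of adeles defined by Boolean combinations of the conditions `Fin` and
`C_j` on the Boolean values of the formulas `ψ`. -/
def boolCombSubalgebra {n l : ℕ} (hl : 1 ≤ l) (ψ : Fin l → Language.ring.Formula (Fin n)) :
    BooleanSubalgebra (Set (AdeleTuple.{u} n)) where
  carrier := {S | ∃ Ψ : BoolComb l, S = {x | Ψ.Holds fun k => boolValue (ψ k) x.val}}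
  supClosed' := by
    rintro _ ⟨Ψ, rfl⟩ _ ⟨Ψ', rfl⟩
    exact ⟨.or Ψ Ψ', rfl⟩
  infClosed' := by
    rintro _ ⟨Ψ, rfl⟩ _ ⟨Ψ', rfl⟩
    exact ⟨.and Ψ Ψ', rfl⟩
  compl_mem' := by
    rintro _ ⟨Ψ, rfl⟩
    exact ⟨.not Ψ, rfl⟩
  -- `BoolComb` has no constant for falsity; `l ≥ 1` provides a condition to contradict.
  bot_mem' := ⟨.and (.fin ⟨0, hl⟩) (.not (.fin ⟨0, hl⟩)), (Set.eq_empty_of_forall_notMem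
    fun _ h => h.2 h.1).symm⟩

/-- The Boolean algebra lives on the tuples over all number fields at once, so a single `Ψ` serves
every `K`. -/
theorem exists_boolComb {n : ℕ} (φ : Language.ring.Formula (Fin n)) :
    ∃ l : ℕ, 1 ≤ l ∧ ∃ (ψ : Fin l → Language.ring.Formula (Fin n)) (Ψ : BoolComb l),
      ∀ (K : Type u) [Field K] [NumberField K] (a : Fin n → 𝔸[K]),
        RingSat φ a ↔ Ψ.Holds (fun k => boolValue (ψ k) a) := by
  obtain ⟨l, hl, ψ, N, h⟩ := exists_boolValues_determining.{u} φ
  obtain ⟨Ψ, hΨ⟩ := (boolCombSubalgebra.{u} hl ψ).mem_of_forall_iff (κ := Fin l ⊕ Fin l × Fin N)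
    (Sum.elim (fun i => {x | IsFin (boolValue (ψ i) x.val)})
      fun p => {x | HasAtoms (p.2 + 1) (boolValue (ψ p.1) x.val)})
    (by
      rintro (i | p)
      · exact ⟨.fin i, rfl⟩
      · exact ⟨.atoms (p.2 + 1) (by omega) p.1, rfl⟩)
    {x | RingSat φ x.val}
    fun x y hxy => h x.K x.val y.K y.val (fun i => hxy (.inl i)) fun i j => hxy (.inr (i, j))
  exact ⟨l, hl, ψ, Ψ, fun K _ _ a => Set.ext_iff.1 hΨ ⟨K, a⟩⟩

theorem RingDefinable.exists_formula {R α : Type*} [CommRing R] {A : Set R} {D : Set (α → R)}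
    (hD : RingDefinable A D) :
    ∃ φ : Language.ring.Formula (A ⊕ α), D = {x | RingSat φ (Sum.elim (↑) x)} := by
  let := FirstOrder.Ring.compatibleRingOfRing R
  exact Set.definable_iff_exists_formula_sum.1 hD

/-- The parameters are additional variables, given the same values at the two points that are
compared. -/
theorem mem_closure_of_ringDefinable {K : Type u} [Field K] [NumberField K] {A : Set 𝔸[K]} {n : ℕ}
    {D : Set (Fin n → 𝔸[K])} (hD : RingDefinable A D) :
    D ∈ BooleanSubalgebra.closure
      ({S : Set (Fin n → 𝔸[K]) | ∃ ψ : Language.ring.Formula (A ⊕ Fin n),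
          S = {x | IsFin (boolValue ψ (Sum.elim (↑) x))}} ∪
       {S : Set (Fin n → 𝔸[K]) | ∃ (j : ℕ) (ψ : Language.ring.Formula (A ⊕ Fin n)),
          1 ≤ j ∧ S = {x | HasAtoms j (boolValue ψ (Sum.elim (↑) x))}}) := by
  obtain ⟨φ, rfl⟩ := hD.exists_formula
  obtain ⟨l, -, ψ, N, h⟩ := exists_boolValues_determining.{u} φ
  let Q : Fin l ⊕ Fin l × Fin N → Set (Fin n → 𝔸[K]) :=
    Sum.elim (fun i => {x | IsFin (boolValue (ψ i) (Sum.elim (↑) x))})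
      fun p => {x | HasAtoms (p.2 + 1) (boolValue (ψ p.1) (Sum.elim (↑) x))}
  refine BooleanSubalgebra.mem_of_forall_iff _ Q ?_ _ fun x y hxy => ?_
  · rintro (i | p)
    · exact BooleanSubalgebra.subset_closure (.inl ⟨ψ i, rfl⟩)
    · exact BooleanSubalgebra.subset_closure (.inr ⟨p.2 + 1, ψ p.1, by omega, rfl⟩)
  · intro hx
    refine h K (Sum.elim (↑) x) K (Sum.elim (↑) y) (fun i => ?_) (fun i j => ?_) ?_
    · have := hxy (.inl i)
      simpa only [Q, Sum.elim_inl, Set.mem_ofPred_eq] using this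
    · have := hxy (.inr (i, j))
      simpa only [Q, Sum.elim_inr, Set.mem_ofPred_eq] using this
    · exact hx

theorem mainTheorem3 :
    -- the conditions `Fin([[ψ(x)]])` and `C_j([[ψ(x)]])` are given by ring formulas, uniformly in `K`
    (∀ (n : ℕ) (ψ : Language.ring.Formula (Fin n)),
      (∃ θ : Language.ring.Formula (Fin n),
        ∀ (K : Type u) [Field K] [NumberField K] (a : Fin n → 𝔸[K]),
          RingSat θ a ↔ IsFin (boolValue ψ a)) ∧
      ∀ j : ℕ, 1 ≤ j → ∃ θ : Language.ring.Formula (Fin n),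
        ∀ (K : Type u) [Field K] [NumberField K] (a : Fin n → 𝔸[K]),
          RingSat θ a ↔ HasAtoms j (boolValue ψ a)) ∧
    -- quantifier elimination, uniformly in `K`
    (∀ (n : ℕ) (φ : Language.ring.Formula (Fin n)),
      ∃ l : ℕ, 1 ≤ l ∧ ∃ (ψ : Fin l → Language.ring.Formula (Fin n)) (Ψ : BoolComb l),
        ∀ (K : Type u) [Field K] [NumberField K] (a : Fin n → 𝔸[K]),
          RingSat φ a ↔ Ψ.Holds (fun k => boolValue (ψ k) a)) ∧
    -- definable sets, with parameters from an arbitrary set `A` of adeles (possibly empty)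
    (∀ (K : Type u) [Field K] [NumberField K] (A : Set 𝔸[K]) (n : ℕ) (D : Set (Fin n → 𝔸[K])),
      RingDefinable A D →
        D ∈ BooleanSubalgebra.closure
          ({S : Set (Fin n → 𝔸[K]) | ∃ ψ : Language.ring.Formula (A ⊕ Fin n),
              S = {x | IsFin (boolValue ψ (Sum.elim (↑) x))}} ∪
           {S : Set (Fin n → 𝔸[K]) | ∃ (j : ℕ) (ψ : Language.ring.Formula (A ⊕ Fin n)),
              1 ≤ j ∧ S = {x | HasAtoms j (boolValue ψ (Sum.elim (↑) x))}})) :=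
  ⟨fun _ ψ => ⟨exists_isFin_formula ψ, fun j _ => exists_hasAtoms_formula ψ j⟩,
    fun _ φ => exists_boolComb φ, fun _ _ _ _ _ _ hD => mem_closure_of_ringDefinable hD⟩
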